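/- Let $0\le M\le n$ be integers and let $\lambda_0\ge\lambda_1\ge\dots\ge\lambda_M\ge 0>\lambda_{M+1}\ge\dots\ge\lambda_n$ be real numbers; if $n\ge 1$, assume moreover that $\lambda_0>\lambda_1$. Suppose that there are an integer $S\ge 0$ and a partition of the list $\lambda_{M+1},\dots,\lambda_n$ (that is, of its index set $\{M+1,\dots,n\}$) into $S$ nonempty parts $\Lambda_1,\dots,\Lambda_S$ such that $|\Lambda_j|$ is odd for $j=1,\dots,\min\{M,S\}$ and such that the sums $T_k=\sum_{\lambda_i\in\Lambda_k}\lambda_i$ satisfy $T_S\ge T_{S-1}\ge\dots\ge T_1$. Put $K=\{i\in\{1,\dots,\min\{M,S\}\}\mid \lambda_i+T_i<0\}$, and suppose that (1) $\displaystyle \lambda_0+\sum_{i\in K,\ i<k}(\lambda_i+T_i)+T_k>0$ for all $k\in K$, and (2) $\displaystyle \lambda_0+\sum_{i\in K}(\lambda_i+T_i)+\sum_{j=M+1}^{S}T_j>0$ (the last sum is $0$ if $S\le M$). Then there is an $(n+1)\times(n+1)$ real matrix $A$ with all entries positive which is bisymmetric, i.e. $A^T=A$ and $JAJ=A$, where $J$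 is the matrix with ones on the anti-diagonal and zeros elsewhere, and whose eigenvalues, counted with multiplicity, are $\lambda_0,\lambda_1,\dots,\lambda_n$. -/

import Mathlib

open scoped Polynomial

/-- The reverse identity matrix `J` of order `m`: ones on the anti-diagonal, zeros elsewhere. -/
def reverseIdentity (m : ℕ) : Matrix (Fin m) (Fin m) ℝ :=
  Matrix.of fun i j => if j = i.rev then 1 else 0

/-- A real square matrix `A` is bisymmetric if `Aᵀ = A` and `J A J = A`. -/
def IsBisymmetric {m : ℕ} (A : Matrix (Fin m) (Fin m) ℝ) : Prop :=
  A.transpose = A ∧ reverseIdentity m * A * reverseIdentity m = A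

/-- A positive matrix: every entry is positive. -/
def IsPositiveMatrix {m : ℕ} (A : Matrix (Fin m) (Fin m) ℝ) : Prop :=
  ∀ i j, 0 < A i j

/-- `A`, of order `n + 1`, has all eigenvalues (with multiplicities) `lam 0, …, lam n`. -/
def HasEigenvalueList {n : ℕ} (A : Matrix (Fin (n + 1)) (Fin (n + 1)) ℝ) (lam : ℕ → ℝ) : Prop :=
  A.charpoly = ∏ i ∈ Finset.range (n + 1), (Polynomial.X - Polynomial.C (lam i))

/-- `P 1, …, P S` is a partition of the index set `I` into `S` nonempty parts.
Values of `P` outside `{1, …, S}` are irrelevant. -/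
structure IsPartitionInto (P : ℕ → Finset ℕ) (S : ℕ) (I : Finset ℕ) : Prop where
  nonempty : ∀ j ∈ Finset.Icc 1 S, (P j).Nonempty
  disjoint : ∀ i ∈ Finset.Icc 1 S, ∀ j ∈ Finset.Icc 1 S, i ≠ j → Disjoint (P i) (P j)
  union_eq : (Finset.Icc 1 S).biUnion P = I

/-- `T k`, the sum of the numbers `lam i` whose index lies in the `k`-th part. -/
def partSum (lam : ℕ → ℝ) (P : ℕ → Finset ℕ) (k : ℕ) : ℝ :=
  ∑ i ∈ P k, lam i

/-- The set `K` of those `i` with `1 ≤ i ≤ min M S` and `lam i + T i < 0`. -/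
noncomputable def deficientSet (lam : ℕ → ℝ) (P : ℕ → Finset ℕ) (M S : ℕ) : Finset ℕ :=
  {i ∈ Finset.Icc 1 (min M S) | lam i + partSum lam P i < 0}

/-!
A matrix on `Fin m` is bisymmetric when it is symmetric and invariant under the involution
`Fin.rev`, which has at most one fixed point, and none if `m` is even. By
`Equiv.Perm.isConj_of_involutive`, all involutions of an `m`-element type with at most one fixed
point are conjugate, so the index set may be any finite type carrying one (`Realizable`).

In this setting Fiedler's gluing of symmetric matrices preserves the symmetry: if `A` and `B` are
invariant under `σ` and `τ` and have positive invariant unit Perron vectors `u` and `v` for the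
eigenvalues `α` and `β`, the block matrix `[[A, r u vᵀ], [r v uᵀ, B]]` is invariant under `σ ⊕ τ`.
For `ν < α, β` and a suitable `r > 0`, its spectrum arises from those of `A` and `B` by replacing `α`
and `β` by `α + β - ν` and `ν`, and its Perron vector is again positive (`Realizable.glue`). The
number of fixed points adds up, so any number of blocks of even order may be glued onto one matrix.

Gluing blocks of order two produces every list of negative numbers `μ i` with the Perron root
`-∑ μ i` (`realizable_of_neg`), by a matrix of even order if the list has odd length, and every list
of nonnegative numbers below a given Perron root (`strictlyRealizable_of_nonneg`). In the theorem,
one starts from the parts with index above `M`, or from the `lam i` with `S < i ≤ M`, with the Perron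
root `lam 0 + ∑ i ∈ K, (lam i + T i)`, and glues on the parts `k = min M S, …, 1` in this order,
replacing the Perron root `-T k` of the `k`-th part by `lam k`. This raises the large Perron root by
`-(lam k + T k)` if `k ∈ K`, and by nothing otherwise. Gluing requires that the current Perron root
exceed `lam k`; this is what the first inequality of the hypotheses and `lam 1 < lam 0` give
(`lt_remainingRoot`). As all inequalities are strict, one can work slightly below the prescribed
Perron roots (`StrictlyRealizable`), and a final summand `c u uᵀ` with `c > 0` makes every entry
positive.
-/

/-! ### Characteristic polynomials of rank-one couplings, and involutions -/

section Charpoly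

open Matrix Polynomial

theorem eq_of_eval_eq_of_ne_zero {p r q : ℝ[X]} (hq : q ≠ 0)
    (h : ∀ x, q.eval x ≠ 0 → p.eval x = r.eval x) : p = r := by
  refine mul_left_cancel₀ hq (Polynomial.funext fun x => ?_)
  rw [eval_mul, eval_mul]
  by_cases hx : q.eval x = 0
  · rw [hx, zero_mul, zero_mul]
  · rw [h x hx]

variable {ι κ : Type*} [Fintype ι] [DecidableEq ι] [Fintype κ] [DecidableEq κ]

theorem scalar_sub_mulVec {A : Matrix ι ι ℝ} {u : ι → ℝ} {α : ℝ} (h : A *ᵥ u = α • u) (x : ℝ) :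
    (scalar ι x - A) *ᵥ u = (x - α) • u := by
  rw [sub_mulVec, h, sub_smul, scalar_apply, ← smul_one_eq_diagonal, smul_mulVec, one_mulVec]

/-- Adding a multiple of `u uᵀ` moves only the eigenvalue of the unit eigenvector `u`. -/
theorem charpoly_add_smul_vecMulVec {A : Matrix ι ι ℝ} {u : ι → ℝ} {α : ℝ} {p : ℝ[X]}
    (hu : u ⬝ᵥ u = 1) (h : A *ᵥ u = α • u) (hA : A.charpoly = (X - C α) * p) (c : ℝ) :
    (A + c • vecMulVec u u).charpoly = (X - C (α + c)) * p := by
  refine eq_of_eval_eq_of_ne_zero (X_sub_C_ne_zero α) fun x hx => ?_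
  rw [eval_sub, eval_X, eval_C] at hx
  have hM := scalar_sub_mulVec h x
  have hdet : (scalar ι x - A).det = (x - α) * p.eval x := by
    rw [← eval_charpoly, hA]; simp
  rw [eval_charpoly]
  have : scalar ι x - (A + c • vecMulVec u u) =
      (scalar ι x - A) * (1 + vecMulVec u (-(c / (x - α)) • u)) := by
    rw [mul_add, mul_one, mul_vecMulVec, hM, smul_vecMulVec, vecMulVec_smul, smul_smul,
      mul_neg, mul_div_cancel₀ _ hx, neg_smul]
    abel
  rw [this, det_mul, hdet, vecMulVec_eq Unit, det_one_add_replicateCol_mul_replicateRow,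
    smul_dotProduct, hu]
  simp only [eval_mul, eval_sub, eval_X, eval_C, smul_eq_mul]
  field_simp
  ring

/-- Coupling `A` and `B` by `r u vᵀ`, for unit eigenvectors `u` and `v`, replaces the eigenvalues `α`
and `β` by those of `[[α, r], [r, β]]` and keeps all others. -/
theorem charpoly_fromBlocks_vecMulVec {A : Matrix ι ι ℝ} {u : ι → ℝ} {α : ℝ} {p : ℝ[X]}
    {B : Matrix κ κ ℝ} {v : κ → ℝ} {β : ℝ} {q : ℝ[X]}
    (hu : u ⬝ᵥ u = 1) (hAu : A *ᵥ u = α • u) (hA : A.charpoly = (X - C α) * p)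
    (hv : v ⬝ᵥ v = 1) (hBv : B *ᵥ v = β • v) (hB : B.charpoly = (X - C β) * q) (r : ℝ) :
    (fromBlocks A (r • vecMulVec u v) (r • vecMulVec v u) B).charpoly =
      ((X - C α) * (X - C β) - C (r ^ 2)) * (p * q) := by
  refine eq_of_eval_eq_of_ne_zero
    (mul_ne_zero (X_sub_C_ne_zero α) (X_sub_C_ne_zero β)) fun x hx => ?_
  simp only [eval_mul, eval_sub, eval_X, eval_C] at hx
  have hxα := left_ne_zero_of_mul hx
  have hxβ := right_ne_zero_of_mul hx
  have hdA : (scalar ι x - A).det = (x - α) * p.eval x := by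
    rw [← eval_charpoly, hA]; simp
  have hdB : (scalar κ x - B).det = (x - β) * q.eval x := by
    rw [← eval_charpoly, hB]; simp
  have hs : scalar (ι ⊕ κ) x = fromBlocks (scalar ι x) 0 0 (scalar κ x) := by
    ext (i | i) (j | j) <;> simp [diagonal_apply]
  have h₁ : (scalar ι x - A) * vecMulVec (-(r / (x - α)) • u) v = -(r • vecMulVec u v) := by
    rw [mul_vecMulVec, mulVec_smul, scalar_sub_mulVec hAu, smul_smul, neg_mul,
      div_mul_cancel₀ _ hxα, smul_vecMulVec, neg_smul]
  have h₂ : (scalar κ x - B) * vecMulVec (-(r / (x - β)) • v) u = -(r • vecMulVec v u) := by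
    rw [mul_vecMulVec, mulVec_smul, scalar_sub_mulVec hBv, smul_smul, neg_mul,
      div_mul_cancel₀ _ hxβ, smul_vecMulVec, neg_smul]
  -- The eigenvector relations let the block-diagonal part be factored out on the left.
  have hfac : scalar (ι ⊕ κ) x - fromBlocks A (r • vecMulVec u v) (r • vecMulVec v u) B =
      fromBlocks (scalar ι x - A) 0 0 (scalar κ x - B) *
        fromBlocks 1 (vecMulVec (-(r / (x - α)) • u) v) (vecMulVec (-(r / (x - β)) • v) u) 1 := by
    rw [hs, fromBlocks_multiply, sub_eq_add_neg, fromBlocks_neg, fromBlocks_add, h₁, h₂]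
    simp [sub_eq_add_neg]
  rw [eval_charpoly, hfac, det_mul, det_fromBlocks_zero₂₁, hdA, hdB, det_fromBlocks_one₁₁,
    vecMulVec_mul_vecMulVec, sub_eq_add_neg 1, ← vecMulVec_neg, vecMulVec_eq Unit,
    det_one_add_replicateCol_mul_replicateRow]
  simp only [dotProduct_smul, smul_dotProduct, neg_dotProduct, hu, hv, smul_eq_mul,
    eval_mul, eval_sub, eval_X, eval_C]
  field_simp
  ring

open Finset in
/-- An involution without two distinct fixed points is determined up to conjugacy by the number of
points it acts on, because its cycle type is then forced by parity. -/
theorem Equiv.Perm.isConj_of_involutive {σ τ : Equiv.Perm ι}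
    (hσ : ∀ i, σ (σ i) = i) (hτ : ∀ i, τ (τ i) = i)
    (hσc : #{i | σ i = i} ≤ 1) (hτc : #{i | τ i = i} ≤ 1) : IsConj σ τ := by
  have key : ∀ f : Equiv.Perm ι, (∀ i, f (f i) = i) → #{i | f i = i} ≤ 1 →
      f.cycleType = Multiset.replicate (Fintype.card ι / 2) 2 := by
    intro f hf hc
    have h2 : ∀ n ∈ f.cycleType, n = 2 := by
      intro n hn
      have h1 := Equiv.Perm.two_le_of_mem_cycleType hn
      have h3 := Equiv.Perm.dvd_of_mem_cycleType hn
      have h4 : orderOf f ∣ 2 := orderOf_dvd_of_pow_eq_one (Equiv.ext fun i => by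
        simp [pow_two, hf])
      have := Nat.le_of_dvd two_pos (h3.trans h4)
      omega
    have h5 := Multiset.eq_replicate_card.2 h2
    have h6 := f.sum_cycleType
    have h7 : #f.support + #{i | f i = i} = Fintype.card ι := by
      have := Finset.card_filter_add_card_filter_not (s := (univ : Finset ι)) (fun i => f i = i)
      rw [Finset.card_univ] at this
      rw [← this, add_comm]
      rfl
    rw [h5, Multiset.sum_replicate, smul_eq_mul] at h6
    rw [h5]
    congr 1
    omega
  rw [Equiv.Perm.isConj_iff_cycleType_eq, key σ hσ hσc, key τ hτ hτc]

end Charpoly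

/-! ### Realizable spectra and Fiedler's gluing -/

section Realizable

open Matrix Polynomial Finset

/-- `A` is a nonnegative symmetric matrix invariant under the permutation `σ` of its index set, `u`
is a positive `σ`-invariant unit eigenvector of `A` for `α`, and `p` is the polynomial whose roots
are the remaining eigenvalues of `A`. -/
structure IsPerronModel {ι : Type} [Fintype ι] [DecidableEq ι] (σ : Equiv.Perm ι)
    (A : Matrix ι ι ℝ) (u : ι → ℝ) (α : ℝ) (p : ℝ[X]) : Prop where
  symm : ∀ i j, A i j = A j i
  inv : ∀ i j, A (σ i) (σ j) = A i j
  nonneg : ∀ i j, 0 ≤ A i j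
  vec_pos : ∀ i, 0 < u i
  vec_inv : ∀ i, u (σ i) = u i
  unit : u ⬝ᵥ u = 1
  mulVec_eq : A *ᵥ u = α • u
  charpoly_eq : A.charpoly = (X - C α) * p

/-- The Perron root `α` together with the roots of `p` is the spectrum of a nonnegative symmetric
matrix invariant under an involution of the index set having at most `k` fixed points, with a
positive invariant Perron vector. The reversal of `Fin m` is such an involution for `k = 1`, and for
`k = 0` if `m` is even. -/
def Realizable (k : ℕ) (α : ℝ) (p : ℝ[X]) : Prop :=
  ∃ (ι : Type) (_ : Fintype ι) (_ : DecidableEq ι) (σ : Equiv.Perm ι) (A : Matrix ι ι ℝ)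
    (u : ι → ℝ), (∀ i, σ (σ i) = i) ∧ #{i | σ i = i} ≤ k ∧ IsPerronModel σ A u α p

/-- Realizability with at most one fixed point and some room below the Perron root. This room is
what makes all entries positive in the end. -/
def StrictlyRealizable (α : ℝ) (p : ℝ[X]) : Prop :=
  ∃ α₀ < α, Realizable 1 α₀ p

variable {k l : ℕ} {α β ν : ℝ} {p q : ℝ[X]}

theorem Realizable.mono (h : Realizable k α p) (hkl : k ≤ l) : Realizable l α p := by
  obtain ⟨ι, i₁, i₂, σ, A, u, hσ, hk, hA⟩ := h
  exact ⟨ι, i₁, i₂, σ, A, u, hσ, hk.trans hkl, hA⟩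

theorem IsPerronModel.add_smul_vecMulVec {ι : Type} [Fintype ι] [DecidableEq ι] {σ : Equiv.Perm ι}
    {A : Matrix ι ι ℝ} {u : ι → ℝ} (h : IsPerronModel σ A u α p) {c : ℝ} (hc : 0 ≤ c) :
    IsPerronModel σ (A + c • vecMulVec u u) u (α + c) p where
  symm i j := by simp [vecMulVec_apply, h.symm i j, mul_comm]
  inv i j := by simp [vecMulVec_apply, h.inv, h.vec_inv]
  nonneg i j := by
    have := h.nonneg i j
    have := h.vec_pos i
    have := h.vec_pos j
    simp only [Matrix.add_apply, Matrix.smul_apply, vecMulVec_apply, smul_eq_mul]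
    positivity
  vec_pos := h.vec_pos
  vec_inv := h.vec_inv
  unit := h.unit
  mulVec_eq := by
    rw [add_mulVec, h.mulVec_eq, smul_mulVec, vecMulVec_mulVec, h.unit, MulOpposite.op_one,
      one_smul, add_smul]
  charpoly_eq := charpoly_add_smul_vecMulVec h.unit h.mulVec_eq h.charpoly_eq c

/-- The Perron root of a realizable spectrum can be increased. -/
theorem Realizable.raise (h : Realizable k α p) (hαβ : α ≤ β) : Realizable k β p := by
  obtain ⟨ι, i₁, i₂, σ, A, u, hσ, hk, hA⟩ := h
  exact ⟨ι, i₁, i₂, σ, _, u, hσ, hk, by simpa using hA.add_smul_vecMulVec (sub_nonneg.2 hαβ)⟩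

theorem realizable_one_zero : Realizable 1 0 1 := by
  refine ⟨Unit, inferInstance, inferInstance, 1, 0, 1, fun _ => rfl, by simp, ?_⟩
  constructor <;> simp [charpoly, charmatrix, dotProduct]

theorem realizable_X_sub_C (h₁ : -ν ≤ α) (h₂ : ν ≤ α) : Realizable 0 α (X - C ν) := by
  refine ⟨Fin 2, inferInstance, inferInstance, Equiv.swap 0 1,
    !![(α + ν) / 2, (α - ν) / 2; (α - ν) / 2, (α + ν) / 2], fun _ => (√2)⁻¹, by simp, by decide, ?_⟩
  have hsq : (√2)⁻¹ * (√2)⁻¹ = (1 / 2 : ℝ) := by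
    rw [← mul_inv, Real.mul_self_sqrt zero_le_two, one_div]
  constructor
  · simp [Fin.forall_fin_two]
  · simp [Fin.forall_fin_two]
  · simp only [Fin.forall_fin_two, of_apply, cons_val_zero, cons_val_one]
    refine ⟨⟨?_, ?_⟩, ?_, ?_⟩ <;> linarith
  · intro i; positivity
  · simp
  · simp only [dotProduct, Fin.sum_univ_two, hsq]; norm_num
  · ext i
    fin_cases i <;> simp [mulVec, dotProduct, Fin.sum_univ_two] <;> ring
  · rw [charpoly_fin_two]
    simp only [trace_fin_two, det_fin_two, of_apply, cons_val_zero, cons_val_one, cons_val']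
    have e₁ : (α + ν) / 2 + (α + ν) / 2 = α + ν := by ring
    have e₂ : (α + ν) / 2 * ((α + ν) / 2) - (α - ν) / 2 * ((α - ν) / 2) = α * ν := by ring
    simp only [e₁, e₂, C_add, C_mul]
    ring

/-- Fiedler's gluing of two symmetric matrices along their Perron vectors: the Perron roots `α` and
`β` are replaced by `α + β - ν` and `ν`. -/
theorem Realizable.glue (hp : Realizable k α p) (hq : Realizable l β q) (hα : ν < α)
    (hβ : ν < β) : Realizable (k + l) (α + β - ν) ((X - C ν) * (p * q)) := by
  obtain ⟨ι, i₁, i₂, σ, A, u, hσ, hk, hA⟩ := hp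
  obtain ⟨κ, j₁, j₂, τ, B, v, hτ, hl, hB⟩ := hq
  obtain ⟨x, hx, hxα⟩ : ∃ x > 0, α = ν + x * x :=
    ⟨√(α - ν), Real.sqrt_pos.2 (sub_pos.2 hα), by rw [Real.mul_self_sqrt] <;> linarith⟩
  obtain ⟨y, hy, hyβ⟩ : ∃ y > 0, β = ν + y * y :=
    ⟨√(β - ν), Real.sqrt_pos.2 (sub_pos.2 hβ), by rw [Real.mul_self_sqrt] <;> linarith⟩
  obtain ⟨w, hw, hwxy⟩ : ∃ w > 0, w * w = x * x + y * y :=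
    ⟨√(x * x + y * y), by positivity, Real.mul_self_sqrt (by positivity)⟩
  -- `(x, y)` is an eigenvector of `[[α, x * y], [x * y, β]]` for the eigenvalue `α + β - ν`.
  refine ⟨ι ⊕ κ, inferInstance, inferInstance, Equiv.sumCongr σ τ,
    fromBlocks A ((x * y) • vecMulVec u v) ((x * y) • vecMulVec v u) B,
    Sum.elim ((x / w) • u) ((y / w) • v), ?_, ?_, ?_⟩
  · rintro (i | i) <;> simp [hσ, hτ]
  · refine le_trans (le_of_eq ?_) (add_le_add hk hl)
    simp only [Finset.card_filter, Fintype.sum_sum_type]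
    simp
  constructor
  · rintro (i | i) (j | j)
    · exact hA.symm i j
    · simp [vecMulVec_apply, mul_comm]
    · simp [vecMulVec_apply, mul_comm]
    · exact hB.symm i j
  · rintro (i | i) (j | j) <;>
      simp [vecMulVec_apply, hA.inv, hB.inv, hA.vec_inv, hB.vec_inv]
  · rintro (i | i) (j | j)
    · exact hA.nonneg i j
    · have := hA.vec_pos i
      have := hB.vec_pos j
      simp only [fromBlocks_apply₁₂, Matrix.smul_apply, vecMulVec_apply, smul_eq_mul]
      positivity
    · have := hB.vec_pos i
      have := hA.vec_pos j
      simp only [fromBlocks_apply₂₁, Matrix.smul_apply, vecMulVec_apply, smul_eq_mul]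
      positivity
    · exact hB.nonneg i j
  · rintro (i | i)
    · exact mul_pos (div_pos hx hw) (hA.vec_pos i)
    · exact mul_pos (div_pos hy hw) (hB.vec_pos i)
  · rintro (i | i) <;> simp [hA.vec_inv, hB.vec_inv]
  · rw [sumElim_dotProduct_sumElim, smul_dotProduct, dotProduct_smul, smul_dotProduct,
      dotProduct_smul, hA.unit, hB.unit]
    simp only [smul_eq_mul]
    field_simp
    linarith
  · rw [fromBlocks_mulVec]
    ext (i | i)
    · simp only [Sum.elim_inl, Sum.elim_comp_inl, Sum.elim_comp_inr, mulVec_smul, hA.mulVec_eq,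
        smul_mulVec, vecMulVec_mulVec, hB.unit, Pi.add_apply, Pi.smul_apply, smul_eq_mul,
        MulOpposite.op_one, one_smul]
      rw [hxα, hyβ]
      field_simp
      ring
    · simp only [Sum.elim_inr, Sum.elim_comp_inl, Sum.elim_comp_inr, mulVec_smul, hB.mulVec_eq,
        smul_mulVec, vecMulVec_mulVec, hA.unit, Pi.add_apply, Pi.smul_apply, smul_eq_mul,
        MulOpposite.op_one, one_smul]
      rw [hxα, hyβ]
      field_simp
      ring
  · rw [charpoly_fromBlocks_vecMulVec hA.unit hA.mulVec_eq hA.charpoly_eq hB.unit hB.mulVec_eq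
      hB.charpoly_eq, ← mul_assoc (X - C (α + β - ν)), hxα, hyβ]
    simp only [C_add, C_sub, C_mul, C_pow]
    ring

/-- Gluing an even block onto a strictly realizable spectrum, with `ν` in place of the Perron root
`β` of the block. If `β ≤ ν`, the Perron root `α` need not grow. -/
theorem StrictlyRealizable.glue {α' : ℝ} (hp : StrictlyRealizable α p) (hq : Realizable 0 β q)
    (hν : ν < α) (h₁ : α ≤ α') (h₂ : α + β - ν ≤ α') :
    StrictlyRealizable α' ((X - C ν) * (p * q)) := by
  obtain ⟨α₀, hα₀, hp⟩ := hp
  -- Both Perron roots are first moved above `ν`, which costs less than the room below `α`.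
  obtain ⟨α₁, hα₁, hlt⟩ := exists_between (max_lt hα₀ hν)
  obtain ⟨h₀₁, hν₁⟩ := max_lt_iff.1 hα₁
  obtain ⟨δ, hδ, hδα⟩ := exists_between (sub_pos.2 hlt)
  refine ⟨α₁ + max β (ν + δ) - ν, ?_,
    (hp.raise h₀₁.le).glue (hq.raise (le_max_left β (ν + δ))) hν₁
      (lt_max_of_lt_right (lt_add_of_pos_right ν hδ))⟩
  rcases max_choice β (ν + δ) with h | h <;> rw [h] <;> linarith

/-- Strictly negative numbers `lam i`, `i ∈ s`, are the eigenvalues besides the Perron root of a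
matrix with trace zero. They are adjoined two at a time, which preserves the parity of the order. -/
theorem realizable_of_neg (lam : ℕ → ℝ) (s : Finset ℕ) (hs : ∀ i ∈ s, lam i < 0) :
    Realizable ((#s + 1) % 2) (-∑ i ∈ s, lam i) (∏ i ∈ s, (X - C (lam i))) := by
  induction hn : #s using Nat.strong_induction_on generalizing s with
  | _ n ih =>
  obtain rfl | ⟨a, ha⟩ := s.eq_empty_or_nonempty
  · subst hn
    simpa using realizable_one_zero
  obtain h₁ | ⟨b, hb⟩ := (s.erase a).eq_empty_or_nonempty
  · obtain rfl : s = {a} := by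
      rw [← Finset.insert_erase ha, h₁, insert_empty_eq]
    subst hn
    have := hs a ha
    simpa using realizable_X_sub_C (ν := lam a) (α := -lam a) le_rfl (by linarith)
  · have hca := Finset.card_erase_of_mem ha
    have hcb := Finset.card_erase_of_mem hb
    have hca' := Finset.card_pos.2 ⟨a, ha⟩
    have hcb' := Finset.card_pos.2 ⟨b, hb⟩
    have hla := hs a ha
    have hlb := hs b (Finset.mem_of_mem_erase hb)
    have hneg : ∀ i ∈ (s.erase a).erase b, lam i < 0 := fun i hi =>
      hs i (Finset.mem_of_mem_erase (Finset.mem_of_mem_erase hi))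
    have hsum := Finset.sum_nonpos fun i hi => (hneg i hi).le
    have h := (ih _ (by omega) ((s.erase a).erase b) hneg rfl).glue (ν := lam a)
      (realizable_X_sub_C (ν := lam b) (α := -lam b) le_rfl (by linarith)) (by linarith)
      (by linarith)
    rw [← Finset.mul_prod_erase s _ ha, ← Finset.mul_prod_erase _ _ hb,
      ← Finset.add_sum_erase s _ ha, ← Finset.add_sum_erase _ _ hb]
    convert h using 1
    · omega
    · ring
    · ring

/-- Nonnegative numbers are adjoined two at a time, the pair `ν' ≤ ν` being the spectrum of a
nonnegative bisymmetric matrix of order two. -/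
theorem strictlyRealizable_of_nonneg (lam : ℕ → ℝ) (s : Finset ℕ) (hα : 0 < α)
    (h0 : ∀ i ∈ s, 0 ≤ lam i) (hlt : ∀ i ∈ s, lam i < α) :
    StrictlyRealizable α (∏ i ∈ s, (X - C (lam i))) := by
  induction hn : #s using Nat.strong_induction_on generalizing s with
  | _ n ih =>
  obtain rfl | ⟨a, ha⟩ := s.eq_empty_or_nonempty
  · exact ⟨0, hα, realizable_one_zero⟩
  obtain ⟨a, ha, hmax⟩ := s.exists_max_image lam ⟨a, ha⟩
  obtain h₁ | ⟨b, hb⟩ := (s.erase a).eq_empty_or_nonempty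
  · rw [← Finset.mul_prod_erase s _ ha, h₁, Finset.prod_empty, mul_one]
    have := h0 a ha
    exact ⟨lam a, hlt a ha, (realizable_X_sub_C (by linarith) le_rfl).mono zero_le_one⟩
  · have hsub := (Finset.erase_subset b _).trans (Finset.erase_subset a s)
    have hbs := Finset.mem_of_mem_erase hb
    have ha0 := h0 a ha
    have hb0 := h0 b hbs
    have hca := Finset.card_erase_lt_of_mem ha
    have hcb := Finset.card_erase_lt_of_mem hb
    have h := (ih _ (by omega) ((s.erase a).erase b) (fun i hi => h0 i (hsub hi))
      (fun i hi => hlt i (hsub hi)) rfl).glue (ν := lam a) (α' := α)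
      (realizable_X_sub_C (ν := lam b) (α := lam a) (by linarith) (hmax b hbs)) (hlt a ha)
      le_rfl (by linarith)
    rw [← Finset.mul_prod_erase s _ ha, ← Finset.mul_prod_erase _ _ hb]
    convert h using 1
    ring

theorem reverseIdentity_mul_mul {m : ℕ} (A : Matrix (Fin m) (Fin m) ℝ) (i j : Fin m) :
    (reverseIdentity m * A * reverseIdentity m) i j = A i.rev j.rev := by
  have h : ∀ k : Fin m, j = k.rev ↔ k = j.rev := fun k => eq_comm.trans Fin.rev_eq_iff
  simp [reverseIdentity, mul_apply, h]

theorem StrictlyRealizable.exists_bisymmetric {n : ℕ} (h : StrictlyRealizable α p)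
    (hp : p.Monic) (hn : p.natDegree = n) :
    ∃ A : Matrix (Fin (n + 1)) (Fin (n + 1)) ℝ,
      IsBisymmetric A ∧ IsPositiveMatrix A ∧ A.charpoly = (X - C α) * p := by
  obtain ⟨α₀, hα, ι, _, _, σ, A₀, u, hσ, hk, hA₀⟩ := h
  have hA := hA₀.add_smul_vecMulVec (sub_pos.2 hα).le
  rw [add_sub_cancel] at hA
  have hpos : ∀ i j, 0 < (A₀ + (α - α₀) • vecMulVec u u) i j := fun i j =>
    add_pos_of_nonneg_of_pos (hA₀.nonneg i j)
      (mul_pos (sub_pos.2 hα) (mul_pos (hA₀.vec_pos i) (hA₀.vec_pos j)))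
  generalize A₀ + (α - α₀) • vecMulVec u u = A at hA hpos
  have hcard : Fintype.card ι = n + 1 := by
    rw [← charpoly_natDegree_eq_dim A, hA.charpoly_eq, (monic_X_sub_C α).natDegree_mul hp,
      natDegree_X_sub_C, hn, add_comm]
  let e := Fintype.equivFinOfCardEq hcard
  have hconj : IsConj (e.permCongr σ) Fin.revPerm := by
    apply Equiv.Perm.isConj_of_involutive
    · simp [hσ]
    · simp
    · refine le_trans (le_of_eq ?_) hk
      refine Finset.card_bij (fun i _ => e.symm i) ?_ ?_ ?_
      · intro i hi
        rw [Finset.mem_filter] at hi ⊢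
        simpa [Equiv.eq_symm_apply] using hi
      · simp
      · intro i hi
        rw [Finset.mem_filter] at hi
        exact ⟨e i, Finset.mem_filter.2 (by simpa using hi), by simp⟩
    · rw [Finset.card_le_one]
      simp only [Finset.mem_filter, Fin.revPerm_apply, Fin.ext_iff, Fin.val_rev]
      omega
  obtain ⟨c, hc⟩ := isConj_iff.1 hconj
  let f : ι ≃ Fin (n + 1) := e.trans c
  have hf : ∀ i, f.symm i.rev = σ (f.symm i) := by
    intro i
    rw [Equiv.symm_apply_eq, ← Fin.revPerm_apply, ← hc]
    simp [f]
  refine ⟨reindex f f A, ⟨?_, ?_⟩, fun i j => hpos _ _, ?_⟩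
  · ext i j
    exact hA.symm _ _
  · ext i j
    rw [reverseIdentity_mul_mul]
    simp [hf, hA.inv]
  · rw [charpoly_reindex, hA.charpoly_eq]

end Realizable

/-! ### Paying the deficits of the parts -/

section DeficientParts

open Polynomial Finset

/-- What is left of `lam 0` once the deficits of the parts `i < k` have been paid. -/
noncomputable def remainingRoot (lam : ℕ → ℝ) (P : ℕ → Finset ℕ) (M S k : ℕ) : ℝ :=
  lam 0 + ∑ i ∈ deficientSet lam P M S with i < k, (lam i + partSum lam P i)

variable {lam : ℕ → ℝ} {P : ℕ → Finset ℕ} {M S k : ℕ}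

theorem mem_deficientSet :
    k ∈ deficientSet lam P M S ↔ (1 ≤ k ∧ k ≤ min M S) ∧ lam k + partSum lam P k < 0 := by
  rw [deficientSet, Finset.mem_filter, Finset.mem_Icc]

theorem remainingRoot_succ_of_mem (hk : k ∈ deficientSet lam P M S) :
    remainingRoot lam P M S (k + 1) =
      remainingRoot lam P M S k + (lam k + partSum lam P k) := by
  have : {i ∈ deficientSet lam P M S | i < k + 1} =
      insert k {i ∈ deficientSet lam P M S | i < k} := by
    ext i
    simp only [Finset.mem_filter, Finset.mem_insert, Nat.lt_succ_iff_lt_or_eq]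
    constructor
    · tauto
    · rintro (rfl | h)
      · exact ⟨hk, Or.inr rfl⟩
      · tauto
  rw [remainingRoot, remainingRoot, this, Finset.sum_insert (by simp)]
  ring

theorem remainingRoot_succ_of_notMem (hk : k ∉ deficientSet lam P M S) :
    remainingRoot lam P M S (k + 1) = remainingRoot lam P M S k := by
  rw [remainingRoot, remainingRoot]
  congr 2
  ext i
  simp only [Finset.mem_filter, Nat.lt_succ_iff_lt_or_eq, and_congr_right_iff]
  rintro hi
  refine ⟨?_, Or.inl⟩
  rintro (h | rfl)
  · exact h
  · exact absurd hi hk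

theorem remainingRoot_one : remainingRoot lam P M S 1 = lam 0 := by
  rw [remainingRoot, Finset.filter_false_of_mem, Finset.sum_empty, add_zero]
  intro i hi
  have := (mem_deficientSet.1 hi).1.1
  omega

theorem remainingRoot_min_add_one : remainingRoot lam P M S (min M S + 1) =
    lam 0 + ∑ i ∈ deficientSet lam P M S, (lam i + partSum lam P i) := by
  rw [remainingRoot, Finset.filter_true_of_mem]
  intro i hi
  exact Nat.lt_succ_of_le (mem_deficientSet.1 hi).1.2

theorem lt_remainingRoot_succ (hk : lam k < remainingRoot lam P M S k)
    (h1 : ∀ k ∈ deficientSet lam P M S, 0 < remainingRoot lam P M S k + partSum lam P k) :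
    lam k < remainingRoot lam P M S (k + 1) := by
  by_cases hK : k ∈ deficientSet lam P M S
  · rw [remainingRoot_succ_of_mem hK]
    linarith [h1 k hK]
  · rwa [remainingRoot_succ_of_notMem hK]

/-- The remaining root always exceeds the next nonnegative eigenvalue, as needed for gluing the
parts in decreasing order of their index. -/
theorem lt_remainingRoot
    (h1 : ∀ k ∈ deficientSet lam P M S, 0 < remainingRoot lam P M S k + partSum lam P k)
    (hanti : ∀ i j, i ≤ j → j ≤ M → lam j ≤ lam i) (hsimple : 1 ≤ M → lam 1 < lam 0)
    (hk : 1 ≤ k) (hkM : k ≤ M) : lam k < remainingRoot lam P M S k := by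
  induction k, hk using Nat.le_induction with
  | base => rw [remainingRoot_one]; exact hsimple hkM
  | succ k hk ih =>
    exact (hanti k (k + 1) k.le_succ hkM).trans_lt
      (lt_remainingRoot_succ (ih (by omega)) h1)

end DeficientParts

theorem mainTheorem7 (n M S : ℕ) (lam : ℕ → ℝ) (P : ℕ → Finset ℕ)
    (hMn : M ≤ n)
    (hanti : ∀ i j, i ≤ j → j ≤ n → lam j ≤ lam i)
    (hnonneg : ∀ i, i ≤ M → 0 ≤ lam i)
    (hneg : ∀ i, M < i → i ≤ n → lam i < 0)
    (hsimple : 1 ≤ n → lam 1 < lam 0)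
    (hpart : IsPartitionInto P S (Finset.Icc (M + 1) n))
    (hodd : ∀ j ∈ Finset.Icc 1 (min M S), Odd (P j).card)
    (hT : ∀ i j, 1 ≤ i → i ≤ j → j ≤ S → partSum lam P i ≤ partSum lam P j)
    (h1 : ∀ k ∈ deficientSet lam P M S,
      0 < lam 0 + (∑ i ∈ deficientSet lam P M S with i < k, (lam i + partSum lam P i))
        + partSum lam P k)
    (h2 : 0 < lam 0 + (∑ i ∈ deficientSet lam P M S, (lam i + partSum lam P i))
        + ∑ j ∈ Finset.Icc (M + 1) S, partSum lam P j) :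
    ∃ A : Matrix (Fin (n + 1)) (Fin (n + 1)) ℝ,
      IsBisymmetric A ∧ IsPositiveMatrix A ∧ HasEigenvalueList A lam := by
  have hlt : ∀ k, 1 ≤ k → k ≤ M → lam k < remainingRoot lam P M S k := fun k =>
    lt_remainingRoot h1 (fun i j hij hj => hanti i j hij (hj.trans hMn))
      fun h => hsimple (h.trans hMn)
  have hnegP : ∀ j, 1 ≤ j → j ≤ S → ∀ i ∈ P j, lam i < 0 := by
    intro j hj hjS i hi
    have : i ∈ Finset.Icc (M + 1) n := by
      rw [← hpart.union_eq]
      exact Finset.mem_biUnion.2 ⟨j, Finset.mem_Icc.2 ⟨hj, hjS⟩, hi⟩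
    rw [Finset.mem_Icc] at this
    exact hneg i this.1 this.2
  set m := min M S with hm
  let F : ℕ → ℝ[X] := fun i => Polynomial.X - Polynomial.C (lam i)
  let G : ℕ → ℝ[X] := fun j => ∏ i ∈ P j, F i
  rw [← remainingRoot_min_add_one, ← hm] at h2
  -- At least one of the two products is empty.
  have hstart : StrictlyRealizable (remainingRoot lam P M S (m + 1))
      ((∏ i ∈ Finset.Ico (m + 1) (M + 1), F i) * ∏ j ∈ Finset.Ico (m + 1) (S + 1), G j) := by
    rcases le_or_gt S M with hSM | hMS
    · have hmS : m = S := min_eq_right hSM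
      rw [Finset.Icc_eq_empty (by omega), Finset.sum_empty, add_zero] at h2
      rw [Finset.Ico_eq_empty (a := m + 1) (b := S + 1) (by omega), Finset.prod_empty, mul_one]
      refine strictlyRealizable_of_nonneg lam _ h2 ?_ ?_ <;> intro i hi <;>
        rw [Finset.mem_Ico] at hi
      · exact hnonneg i (by omega)
      · exact (hanti _ _ hi.1 (by omega)).trans_lt (hlt (m + 1) (by omega) (by omega))
    · have hmM : m = M := min_eq_left hMS.le
      have hdisj : ((Finset.Icc (M + 1) S : Finset ℕ) : Set ℕ).PairwiseDisjoint P := by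
        intro i hi j hj hij
        rw [Finset.mem_coe, Finset.mem_Icc] at hi hj
        exact hpart.disjoint i (Finset.mem_Icc.2 ⟨by omega, hi.2⟩) j
          (Finset.mem_Icc.2 ⟨by omega, hj.2⟩) hij
      have hr := realizable_of_neg lam ((Finset.Icc (M + 1) S).biUnion P) (by
        intro i hi
        obtain ⟨j, hj, hi⟩ := Finset.mem_biUnion.1 hi
        rw [Finset.mem_Icc] at hj
        exact hnegP j (by omega) hj.2 i hi)
      rw [Finset.sum_biUnion hdisj, Finset.prod_biUnion hdisj] at hr
      rw [Finset.Ico_eq_empty (a := m + 1) (b := M + 1) (by omega), Finset.prod_empty, one_mul,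
        hmM, Finset.Ico_add_one_right_eq_Icc]
      rw [hmM] at h2
      refine ⟨_, ?_, hr.mono (by omega)⟩
      unfold partSum at h2
      linarith
  have hglue : ∀ k, 1 ≤ k → k ≤ m + 1 → StrictlyRealizable (remainingRoot lam P M S k)
      ((∏ i ∈ Finset.Ico k (M + 1), F i) * ∏ j ∈ Finset.Ico k (S + 1), G j) := by
    intro k hk hkm
    induction hkm using Nat.decreasingInduction with
    | self => exact hstart
    | of_succ k hkm ih =>
      have hP := realizable_of_neg lam (P k) (hnegP k hk (by omega))
      rw [Nat.even_iff.1 (hodd k (Finset.mem_Icc.2 ⟨hk, by omega⟩)).add_one] at hP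
      rw [Finset.prod_eq_prod_Ico_succ_bot (by omega : k < M + 1),
        Finset.prod_eq_prod_Ico_succ_bot (by omega : k < S + 1)]
      have hν := lt_remainingRoot_succ (hlt k hk (by omega)) h1
      have key : remainingRoot lam P M S (k + 1) ≤ remainingRoot lam P M S k ∧
          remainingRoot lam P M S (k + 1) + -partSum lam P k - lam k ≤
            remainingRoot lam P M S k := by
        by_cases hK : k ∈ deficientSet lam P M S
        · rw [remainingRoot_succ_of_mem hK]
          constructor <;> linarith [(mem_deficientSet.1 hK).2]
        · rw [remainingRoot_succ_of_notMem hK]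
          have : ¬ lam k + partSum lam P k < 0 := fun h =>
            hK (mem_deficientSet.2 ⟨⟨hk, by omega⟩, h⟩)
          constructor <;> linarith
      convert (ih (by omega)).glue hP hν key.1 key.2 using 1
      simp only [F, G]
      ring
  have hprod : (∏ i ∈ Finset.Ico 1 (M + 1), F i) * ∏ j ∈ Finset.Ico 1 (S + 1), G j =
      ∏ i ∈ Finset.range n, F (i + 1) := by
    have hdisj : ((Finset.Icc 1 S : Finset ℕ) : Set ℕ).PairwiseDisjoint P :=
      fun i hi j hj hij => hpart.disjoint i hi j hj hij
    rw [Finset.Ico_add_one_right_eq_Icc 1 S, ← Finset.prod_biUnion hdisj, hpart.union_eq,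
      ← Finset.Ico_add_one_right_eq_Icc, Finset.prod_Ico_consecutive _ (by omega) (by omega),
      Finset.prod_Ico_eq_prod_range]
    simp only [Nat.add_sub_cancel, add_comm 1]
  have h := hglue 1 le_rfl (by omega)
  rw [remainingRoot_one, hprod] at h
  obtain ⟨A, hA, hpos, hchar⟩ := h.exists_bisymmetric
    (Polynomial.monic_prod_of_monic _ _ fun i _ => Polynomial.monic_X_sub_C _)
    (n := n) (by
      rw [Polynomial.natDegree_prod_of_monic _ _ fun i _ => Polynomial.monic_X_sub_C _]
      simp [F])
  refine ⟨A, hA, hpos, ?_⟩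
  rw [HasEigenvalueList, hchar, Finset.prod_range_succ']
  exact mul_comm _ _
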